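/- Let $N$ be a natural number, and consider $N$ access points with positive prices $p_1,\dots,p_N>0$. Let $u:[0,\infty)\to\mathbb{R}$ (the inverse demand function) be continuous, bounded, nonnegative and decreasing (not necessarily strictly). For each $i\in\{1,\dots,N\}$ let $l_i:[0,\infty)^N\to\mathbb{R}$ (the congestion function of access point $i$) be continuous and satisfy $l_i(\mathbf{x})\ge x_i$ for all $\mathbf{x}\in[0,\infty)^N$. Then there exists a Wardrop equilibrium, that is, a flow vector $\mathbf{x}=(x_1,\dots,x_N)\in[0,\infty)^N$ such that for every $i$: 1. if $x_i>0$, then $p_i+l_i(\mathbf{x})=u\big(\sum_{j=1}^N x_j\big)$; 2. if $x_i=0$, then $p_i+l_i(\mathbf{x})\ge u\big(\sum_{j=1}^N x_j\big)$. -/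

import Mathlib

open Set

/-- A flow distribution on `N` access points: a vector of nonnegative flows.
This is the nonnegative orthant of `ℝ^N`. -/
def flowOrthant (N : ℕ) : Set (Fin N → ℝ) :=
  {x | ∀ i, 0 ≤ x i}

/-- The disutility of accessing access point `i` under the flow distribution `x`:
its price plus its congestion level. -/
def disutility {N : ℕ} (p : Fin N → ℝ) (l : Fin N → (Fin N → ℝ) → ℝ)
    (x : Fin N → ℝ) (i : Fin N) : ℝ :=
  p i + l i x

/-- `x` is a Wardrop equilibrium for the prices `p`, congestion functions `l` and inverse demand
function `u`: a flow distribution for which every used access point has disutility equal to `u` at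
the total flow, and every unused one has disutility at least that. -/
structure IsWardropEquilibrium {N : ℕ} (p : Fin N → ℝ) (l : Fin N → (Fin N → ℝ) → ℝ)
    (u : ℝ → ℝ) (x : Fin N → ℝ) : Prop where
  mem_orthant : x ∈ flowOrthant N
  eq_of_pos : ∀ i, 0 < x i → disutility p l x i = u (∑ j, x j)
  ge_of_zero : ∀ i, x i = 0 → u (∑ j, x j) ≤ disutility p l x i

/-! Equilibrium is a complementarity problem, solved by a covering argument. Add a slack coordinate
and scale the simplex so that its points describe all flows of total at most `R`. Let `A (some i)`
be the points where the disutility of `i` is at most `u`, and `A none` those where every disutility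
is at least `u`. These closed sets cover the simplex, so some point lies in the set of each
coordinate of its support: used access points have disutility at most `u`. This bounds each flow by
the bound `M` of `u`, so for `R > N * M` the slack is positive, and membership in `A none` gives the
reverse inequalities.

The covering statement is the limit of a combinatorial one on ever finer lattices: Scarf's lemma,
applied to the coordinate orders on lattice points of the simplex. Scarf's lemma is a parity count
of incidences between doors and cells. Every door has two cells, except the outer one, which has
one; a cell that is not colourful has an even number of doors. Hence a colourful cell exists. -/

/-- `σ` is dominant for the set of criteria `C`: no point beats, in all criteria of `C` at once,
the worst point of `σ`. -/
def Dominant {I T L : Type*} [LinearOrder L] (k : I → T → L) (σ : Finset T) (C : Finset I) : Prop :=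
  ∀ y, ∃ i ∈ C, ∀ x ∈ σ, k i y ≤ k i x

/-! ### Scarf's lemma by a parity count of doors and cells. -/

section Scarf

variable {I T L : Type*} [LinearOrder L] {k : I → T → L}

theorem Dominant.mono {σ τ : Finset T} {C D : Finset I} (h : Dominant k σ C) (hτ : τ ⊆ σ)
    (hC : C ⊆ D) : Dominant k τ D := fun y =>
  let ⟨i, hi, hy⟩ := h y
  ⟨i, hC hi, fun x hx => hy x (hτ hx)⟩

variable [DecidableEq I] [DecidableEq T]

/-- The cells incident to a door `(τ, D)`, in terms of the cardinalities. -/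
theorem incident_cases {σ τ : Finset T} {C D : Finset I} (hd : τ.card + 1 = D.card)
    (hr : σ.card = C.card) (hτ : τ ⊆ σ) (hC : C ⊆ D) :
    (σ = τ ∧ ∃ j ∈ D, C = D.erase j) ∨ (C = D ∧ ∃ x, x ∉ τ ∧ σ = insert x τ) := by
  have h1 := Finset.card_le_card hτ
  have h2 := Finset.card_le_card hC
  by_cases h : σ.card = τ.card
  · left
    have hs : σ = τ := (Finset.eq_of_subset_of_card_le hτ h.le).symm
    refine ⟨hs, ?_⟩
    have : C ⊂ D := Finset.ssubset_iff_subset_ne.2 ⟨hC, by rintro rfl; omega⟩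
    obtain ⟨j, hj, hj'⟩ := Finset.exists_of_ssubset this
    refine ⟨j, hj, Finset.eq_of_subset_of_card_le (Finset.subset_erase.2 ⟨hC, hj'⟩) ?_⟩
    rw [Finset.card_erase_of_mem hj]; omega
  · right
    have hc : C = D := Finset.eq_of_subset_of_card_le hC (by omega)
    refine ⟨hc, ?_⟩
    have : τ ⊂ σ := Finset.ssubset_iff_subset_ne.2 ⟨hτ, by rintro rfl; omega⟩
    obtain ⟨x, hx, hx'⟩ := Finset.exists_of_ssubset this
    refine ⟨x, hx', (Finset.eq_of_subset_of_card_le (Finset.insert_subset hx hτ) ?_).symm⟩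
    rw [Finset.card_insert_of_notMem hx']; omega

variable [Fintype I] [Fintype T]

open Classical in
/-- Dominant pairs with as many points as criteria. -/
noncomputable def cells (k : I → T → L) : Finset (Finset T × Finset I) :=
  Finset.univ.filter fun r => Dominant k r.1 r.2 ∧ r.1.card = r.2.card

open Classical in
/-- Dominant pairs with one point less than criteria, whose colours are all criteria but `i₀`. -/
noncomputable def doors (k : I → T → L) (c : T → I) (i₀ : I) : Finset (Finset T × Finset I) :=
  Finset.univ.filter fun d => Dominant k d.1 d.2 ∧ d.1.card + 1 = d.2.card ∧ i₀ ∈ d.2 ∧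
    d.1.image c = d.2.erase i₀

omit [DecidableEq I] [DecidableEq T] in
theorem mem_cells {σ : Finset T} {C : Finset I} :
    (σ, C) ∈ cells k ↔ Dominant k σ C ∧ σ.card = C.card := by
  simp [cells]

omit [DecidableEq T] in
theorem mem_doors {c : T → I} {i₀ : I} {τ : Finset T} {D : Finset I} :
    (τ, D) ∈ doors k c i₀ ↔ Dominant k τ D ∧ τ.card + 1 = D.card ∧ i₀ ∈ D ∧
      τ.image c = D.erase i₀ := by
  simp only [doors, Finset.mem_filter, Finset.mem_univ, true_and]

/-- Incidence between doors and cells. -/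
def Incident (d r : Finset T × Finset I) : Prop := d.1 ⊆ r.1 ∧ r.2 ⊆ d.2

/-- The criterion `j` is the one exchanged on passing from the door `(τ, D)` to an incident cell:
there is exactly one such cell. -/
theorem existsUnique_cell_exchange (hk : ∀ i, Function.Injective (k i)) {τ : Finset T}
    {D : Finset I} (hdom : Dominant k τ D) (hcard : τ.card + 1 = D.card) {m : I → T}
    (hmτ : ∀ i, m i ∈ τ) (hmin : ∀ i, ∀ x ∈ τ, k i (m i) ≤ k i x) {j : I} (hj : j ∈ D)
    (hsurj : ∀ y ∈ τ, ∃ i ∈ D.erase j, m i = y) :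
    ∃ r ∈ cells k, Incident (τ, D) r ∧
      (r = (τ, D.erase j) ∨ ∃ x, x ∉ τ ∧ r = (insert x τ, D) ∧
        ∀ i ∈ D.erase j, k i (m i) < k i x) ∧
      (∀ r' ∈ cells k, (r' = (τ, D.erase j) ∨ ∃ x, x ∉ τ ∧ r' = (insert x τ, D) ∧
        ∀ i ∈ D.erase j, k i (m i) < k i x) → r' = r) := by
  classical
  -- Candidates for insertion. If there are none, dropping `j` keeps the pair dominant; otherwise
  -- the `k j`-largest candidate is inserted.
  let S : Finset T := Finset.univ.filter fun x => ∀ i ∈ D.erase j, k i (m i) < k i x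
  have hS : ∀ x, x ∈ S ↔ ∀ i ∈ D.erase j, k i (m i) < k i x := fun x => by simp [S]
  have hSτ : ∀ x ∈ S, x ∉ τ := by
    intro x hx hxτ
    obtain ⟨i, hi, rfl⟩ := hsurj x hxτ
    exact lt_irrefl _ ((hS _).1 hx i hi)
  -- Dominance of the door at a candidate can only be witnessed by `j`, so an inserted candidate
  -- becomes the `j`-minimum.
  have hSj : ∀ x ∈ S, k j x ≤ k j (m j) := by
    intro x hx
    obtain ⟨i, hi, h⟩ := hdom x
    by_cases hij : i = j
    · subst hij; exact h _ (hmτ _)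
    · exact absurd (h _ (hmτ i)) (not_le.2 ((hS x).1 hx i (Finset.mem_erase.2 ⟨hij, hi⟩)))
  rcases S.eq_empty_or_nonempty with hempty | hne
  · have hnone : ∀ x, ¬ ∀ i ∈ D.erase j, k i (m i) < k i x := fun x hx => by
      have := (hS x).2 hx
      simp [hempty] at this
    refine ⟨(τ, D.erase j), ?_, ⟨Finset.Subset.refl _, Finset.erase_subset _ _⟩, Or.inl rfl, ?_⟩
    · refine mem_cells.2 ⟨fun y => ?_, ?_⟩
      · have := hnone y
        push Not at this
        obtain ⟨i, hi, h⟩ := this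
        exact ⟨i, hi, fun x hx => h.trans (hmin i x hx)⟩
      · rw [Finset.card_erase_of_mem hj]; omega
    · rintro r' - (h | ⟨x, -, -, h⟩)
      · exact h
      · exact absurd h (hnone x)
  · obtain ⟨x, hxS, hxmax⟩ := S.exists_max_image (k j) hne
    refine ⟨(insert x τ, D), ?_, ⟨Finset.subset_insert _ _, Finset.Subset.refl _⟩,
      Or.inr ⟨x, hSτ x hxS, rfl, (hS x).1 hxS⟩, ?_⟩
    · refine mem_cells.2 ⟨fun y => ?_, by rw [Finset.card_insert_of_notMem (hSτ x hxS), hcard]⟩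
      by_cases hy : y ∈ S
      · refine ⟨j, hj, fun z hz => ?_⟩
        rcases Finset.mem_insert.1 hz with rfl | hz
        · exact hxmax y hy
        · exact (hSj y hy).trans (hmin j z hz)
      · rw [hS] at hy
        push Not at hy
        obtain ⟨i, hi, h⟩ := hy
        refine ⟨i, Finset.mem_of_mem_erase hi, fun z hz => ?_⟩
        rcases Finset.mem_insert.1 hz with rfl | hz
        · exact h.trans ((hS _).1 hxS i hi).le
        · exact h.trans (hmin i z hz)
    · rintro r' hr' (rfl | ⟨x', hx'τ, rfl, hx'⟩)
      · obtain ⟨i, hi, h⟩ := (mem_cells.1 hr').1 x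
        exact absurd (h _ (hmτ i)) (not_le.2 ((hS x).1 hxS i hi))
      · have hx'S := (hS x').2 hx'
        obtain ⟨i, hi, h⟩ := (mem_cells.1 hr').1 x
        have hij : i = j := by
          by_contra hij
          exact absurd (h _ (Finset.mem_insert_of_mem (hmτ i)))
            (not_le.2 ((hS x).1 hxS i (Finset.mem_erase.2 ⟨hij, hi⟩)))
        subst hij
        rw [hk i (le_antisymm (hxmax x' hx'S) (h x' (Finset.mem_insert_self _ _)))]

open Classical in
-- Dominance makes `m`, sending a criterion to the minimum of `τ`, a map from `D` onto `τ`. As `D`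
-- has one element more, exactly one pair `a ≠ b` collides. These are the criteria that can be
-- exchanged, and each yields one cell.
theorem card_cells_of_door (hk : ∀ i, Function.Injective (k i)) {τ : Finset T} {D : Finset I}
    (hdom : Dominant k τ D) (hcard : τ.card + 1 = D.card) (hne : τ.Nonempty) :
    ((cells k).filter fun r => Incident (τ, D) r).card = 2 := by
  choose m hmτ hmin using fun i => τ.exists_min_image (k i) hne
  have hm_eq : ∀ i, ∀ y ∈ τ, (∀ x ∈ τ, k i y ≤ k i x) → m i = y := fun i y hy h =>
    hk i (le_antisymm (hmin i y hy) (h _ (hmτ i)))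
  obtain ⟨a, ha, b, hb, hab, hmab⟩ := Finset.exists_ne_map_eq_of_card_lt_of_maps_to
    (s := D) (t := τ) (f := m) (by omega) (fun i _ => hmτ i)
  have hsurjD : ∀ y ∈ τ, ∃ i ∈ D, m i = y := fun y hy =>
    let ⟨i, hi, h⟩ := hdom y
    ⟨i, hi, hm_eq i y hy h⟩
  have hsa : ∀ y ∈ τ, ∃ i ∈ D.erase a, m i = y := fun y hy => by
    obtain ⟨i, hi, h⟩ := hsurjD y hy
    by_cases hia : i = a
    · subst hia; exact ⟨b, Finset.mem_erase.2 ⟨hab.symm, hb⟩, hmab ▸ h⟩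
    · exact ⟨i, Finset.mem_erase.2 ⟨hia, hi⟩, h⟩
  have hsb : ∀ y ∈ τ, ∃ i ∈ D.erase b, m i = y := fun y hy => by
    obtain ⟨i, hi, h⟩ := hsurjD y hy
    by_cases hib : i = b
    · subst hib; exact ⟨a, Finset.mem_erase.2 ⟨hab, ha⟩, hmab.trans h⟩
    · exact ⟨i, Finset.mem_erase.2 ⟨hib, hi⟩, h⟩
  have hinj : ∀ j ∈ D, (∀ y ∈ τ, ∃ i ∈ D.erase j, m i = y) → Set.InjOn m (D.erase j) := by
    intro j hj hs
    refine Finset.card_image_iff.1 (le_antisymm Finset.card_image_le ?_)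
    rw [Finset.card_erase_of_mem hj]
    have : τ ⊆ (D.erase j).image m := fun y hy => Finset.mem_image.2 (hs y hy)
    have := Finset.card_le_card this
    omega
  have hj_ab : ∀ j ∈ D, (∀ y ∈ τ, ∃ i ∈ D.erase j, m i = y) → j = a ∨ j = b := by
    intro j hj hs
    by_contra h
    push Not at h
    exact hab (hinj j hj hs (Finset.mem_coe.2 (Finset.mem_erase.2 ⟨h.1.symm, ha⟩))
      (Finset.mem_coe.2 (Finset.mem_erase.2 ⟨h.2.symm, hb⟩)) hmab)
  obtain ⟨ra, hra, hia, hfa, hua⟩ :=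
    existsUnique_cell_exchange hk hdom hcard hmτ hmin ha hsa
  obtain ⟨rb, hrb, hib, hfb, hub⟩ :=
    existsUnique_cell_exchange hk hdom hcard hmτ hmin hb hsb
  -- A common cell would have to insert one point exceeding the minima of `τ` in all of `D`, against
  -- dominance.
  have hne : ra ≠ rb := by
    intro hrab
    rw [← hrab] at hfb
    rcases hfa with rfl | ⟨x, hx, rfl, hxa⟩
    · rcases hfb with h | ⟨y, hy, h, -⟩
      · have h2 := (Prod.mk.inj h).2
        exact Finset.notMem_erase a D (h2 ▸ Finset.mem_erase.2 ⟨hab, ha⟩)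
      · exact hy ((Prod.mk.inj h).1 ▸ Finset.mem_insert_self y τ)
    · rcases hfb with h | ⟨y, hy, h, hyb⟩
      · exact hx ((Prod.mk.inj h).1 ▸ Finset.mem_insert_self x τ)
      · have hxy : x = y := by
          have : x ∈ insert y τ := (Prod.mk.inj h).1 ▸ Finset.mem_insert_self x τ
          exact (Finset.mem_insert.1 this).resolve_right hx
        subst hxy
        obtain ⟨i, hi, h⟩ := hdom x
        refine absurd (h _ (hmτ i)) (not_le.2 ?_)
        by_cases hia : i = a
        · exact hyb i (Finset.mem_erase.2 ⟨hia ▸ hab, hi⟩)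
        · exact hxa i (Finset.mem_erase.2 ⟨hia, hi⟩)
  rw [Finset.card_eq_two]
  refine ⟨ra, rb, hne, ?_⟩
  ext ⟨σ, C⟩
  simp only [Finset.mem_filter, Finset.mem_insert, Finset.mem_singleton]
  constructor
  · rintro ⟨hr, hτσ, hCD⟩
    obtain ⟨hd, hc⟩ := mem_cells.1 hr
    suffices ∃ j ∈ D, (∀ y ∈ τ, ∃ i ∈ D.erase j, m i = y) ∧
        ((σ, C) = (τ, D.erase j) ∨ ∃ x, x ∉ τ ∧ (σ, C) = (insert x τ, D) ∧
          ∀ i ∈ D.erase j, k i (m i) < k i x) by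
      obtain ⟨j, hj, hs, h⟩ := this
      rcases hj_ab j hj hs with rfl | rfl
      · exact Or.inl (hua _ hr h)
      · exact Or.inr (hub _ hr h)
    rcases incident_cases hcard hc hτσ hCD with ⟨rfl, j, hj, rfl⟩ | ⟨rfl, x, hx, rfl⟩
    · refine ⟨j, hj, fun y hy => ?_, Or.inl rfl⟩
      obtain ⟨i, hi, h⟩ := hd y
      exact ⟨i, hi, hm_eq i y hy h⟩
    -- The exchanged criterion is the one in which `x` is the minimum of the enlarged set; every
    -- point of `τ` is then the minimum for some other criterion.
    · obtain ⟨j, hj, hjx⟩ := hd x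
      have hex : ∀ y ∈ τ, ∃ i ∈ C.erase j, m i = y ∧ k i y < k i x := by
        intro y hy
        obtain ⟨i, hi, h⟩ := hd y
        have hyx : y ≠ x := fun h => hx (h ▸ hy)
        refine ⟨i, Finset.mem_erase.2 ⟨?_, hi⟩,
          hm_eq i y hy fun z hz => h z (Finset.mem_insert_of_mem hz),
          lt_of_le_of_ne (h x (Finset.mem_insert_self _ _)) fun e => hyx (hk i e)⟩
        rintro rfl
        exact hyx (hk i (le_antisymm (h x (Finset.mem_insert_self _ _))
          (hjx y (Finset.mem_insert_of_mem hy))))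
      have hs : ∀ y ∈ τ, ∃ i ∈ C.erase j, m i = y := fun y hy =>
        let ⟨i, hi, h, _⟩ := hex y hy
        ⟨i, hi, h⟩
      refine ⟨j, hj, hs, Or.inr ⟨x, hx, rfl, fun i hi => ?_⟩⟩
      obtain ⟨i', hi', h, hlt⟩ := hex (m i) (hmτ i)
      obtain rfl := hinj j hj hs (Finset.mem_coe.2 hi') (Finset.mem_coe.2 hi) h
      exact hlt
  · rintro (rfl | rfl)
    · exact ⟨hra, hia⟩
    · exact ⟨hrb, hib⟩

open Classical in
-- Dropping the only criterion leaves none, which cannot dominate; inserting a point works only for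
-- the `k i₀`-maximum.
theorem card_cells_of_outer_door [Nonempty T] (hk : ∀ i, Function.Injective (k i)) (i₀ : I) :
    ((cells k).filter fun r => Incident ((∅ : Finset T), ({i₀} : Finset I)) r).card = 1 := by
  obtain ⟨x, -, hx⟩ := (Finset.univ : Finset T).exists_max_image (k i₀) Finset.univ_nonempty
  rw [Finset.card_eq_one]
  refine ⟨({x}, {i₀}), ?_⟩
  ext ⟨σ, C⟩
  simp only [Finset.mem_filter, Finset.mem_singleton]
  constructor
  · rintro ⟨hr, hτσ, hCD⟩
    obtain ⟨hd, hc⟩ := mem_cells.1 hr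
    rcases incident_cases (by simp) hc hτσ hCD with ⟨rfl, j, hj, rfl⟩ | ⟨rfl, y, -, rfl⟩
    · obtain ⟨i, hi, -⟩ := hd x
      simp [Finset.mem_singleton.1 hj] at hi
    · obtain ⟨i, hi, h⟩ := hd x
      obtain rfl := Finset.mem_singleton.1 hi
      rw [hk i (le_antisymm (h y (by simp)) (hx y (Finset.mem_univ _)))]
      simp
  · intro h
    obtain ⟨rfl, rfl⟩ := Prod.mk.inj h
    refine ⟨mem_cells.2 ⟨fun y => ⟨i₀, by simp, fun z hz => ?_⟩, by simp⟩, by simp [Incident]⟩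
    rw [Finset.mem_singleton.1 hz]
    exact hx y (Finset.mem_univ _)

open Classical in
-- Suppose removing `x` gives a door. Then `σ.erase x` carries each colour of `C.erase i₀` once, and
-- `c x ≠ i₀` since the cell is not colourful. If `c x ∈ C`, one other point `y` has this colour,
-- and removing `y` gives the second door; if not, adding the criterion `c x` does. If no removal
-- gives a door, there is no door at all.
theorem even_card_doors_of_cell {c : T → I} {i₀ : I} {σ : Finset T} {C : Finset I}
    (hr : (σ, C) ∈ cells k) (hcol : σ.image c ≠ C) :
    Even ((doors k c i₀).filter fun d => Incident d (σ, C)).card := by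
  obtain ⟨hdom, hcard⟩ := mem_cells.1 hr
  by_cases hdoor : ∃ x ∈ σ, i₀ ∈ C ∧ (σ.erase x).image c = C.erase i₀
  · obtain ⟨x, hx, hi, him⟩ := hdoor
    have hinj : Set.InjOn c (σ.erase x) := by
      refine Finset.card_image_iff.1 ?_
      rw [him, Finset.card_erase_of_mem hi, Finset.card_erase_of_mem hx, hcard]
    have hσ : σ.image c = insert (c x) (C.erase i₀) := by
      rw [← him, ← Finset.image_insert, Finset.insert_erase hx]
    have hne : c x ≠ i₀ := by
      intro h
      rw [h, Finset.insert_erase hi] at hσ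
      exact hcol hσ
    have hσpos : 0 < σ.card := Finset.card_pos.2 ⟨x, hx⟩
    have door_erase : ∀ z ∈ σ, (σ.erase z).image c = C.erase i₀ →
        (σ.erase z, C) ∈ doors k c i₀ ∧ Incident (σ.erase z, C) (σ, C) := fun z hz h =>
      ⟨mem_doors.2 ⟨hdom.mono (Finset.erase_subset _ _) (Finset.Subset.refl _),
        by rw [Finset.card_erase_of_mem hz]; omega, hi, h⟩,
        Finset.erase_subset _ _, Finset.Subset.refl _⟩
    by_cases hcx : c x ∈ C
    · obtain ⟨y, hy, hyx⟩ : ∃ y ∈ σ.erase x, c y = c x := by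
        rw [← Finset.mem_image, him]
        exact Finset.mem_erase.2 ⟨hne, hcx⟩
      obtain ⟨hyne, hyσ⟩ := Finset.mem_erase.1 hy
      have himy : (σ.erase y).image c = C.erase i₀ := by
        rw [← him]
        ext t
        simp only [Finset.mem_image, Finset.mem_erase]
        constructor
        · rintro ⟨z, ⟨hzy, hz⟩, rfl⟩
          by_cases hzx : z = x
          · exact ⟨y, ⟨hyne, hyσ⟩, by rw [hyx, hzx]⟩
          · exact ⟨z, ⟨hzx, hz⟩, rfl⟩
        · rintro ⟨z, ⟨hzx, hz⟩, rfl⟩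
          by_cases hzy : z = y
          · exact ⟨x, ⟨hyne.symm, hx⟩, by rw [hzy, hyx]⟩
          · exact ⟨z, ⟨hzy, hz⟩, rfl⟩
      refine ⟨1, Finset.card_eq_two.2 ⟨(σ.erase x, C), (σ.erase y, C), ?_, ?_⟩⟩
      · intro h
        exact Finset.notMem_erase y σ ((Prod.mk.inj h).1 ▸ hy)
      · ext ⟨τ, D⟩
        simp only [Finset.mem_filter, Finset.mem_insert, Finset.mem_singleton]
        constructor
        · rintro ⟨hd, hτσ, hCD⟩
          obtain ⟨-, hdc, hiD, hdim⟩ := mem_doors.1 hd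
          rcases incident_cases hdc hcard hτσ hCD with ⟨rfl, j, hj, rfl⟩ | ⟨rfl, z, hz, rfl⟩
          · exfalso
            have hij : i₀ ∈ D.erase j := hi
            have hj' : j ∈ D.erase i₀ :=
              Finset.mem_erase.2 ⟨(Finset.ne_of_mem_erase hij).symm, hj⟩
            rw [← hdim, hσ] at hj'
            rcases Finset.mem_insert.1 hj' with h | h
            · exact Finset.notMem_erase _ _ (h ▸ hcx)
            · exact Finset.notMem_erase _ _ (Finset.mem_of_mem_erase h)
          · have hτ : (insert z τ).erase z = τ := Finset.erase_insert hz
            by_cases hzx : z = x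
            · subst hzx; left; rw [hτ]
            · by_cases hzy : z = y
              · subst hzy; right; rw [hτ]
              · exfalso
                have hcz : c z ∈ τ.image c := by
                  rw [hdim, ← him]
                  exact Finset.mem_image_of_mem c
                    (Finset.mem_erase.2 ⟨hzx, Finset.mem_insert_self _ _⟩)
                have hcard' : (τ.image c).card = τ.card := by
                  rw [hdim, Finset.card_erase_of_mem hi]; omega
                have hxτ : x ∈ τ := (Finset.mem_insert.1 hx).resolve_left (Ne.symm hzx)
                have hyτ : y ∈ τ := (Finset.mem_insert.1 hyσ).resolve_left (Ne.symm hzy)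
                exact hyne (Finset.card_image_iff.1 hcard' hyτ hxτ hyx)
        · rintro (h | h)
          · obtain ⟨rfl, rfl⟩ := Prod.mk.inj h
            exact door_erase x hx him
          · obtain ⟨rfl, rfl⟩ := Prod.mk.inj h
            exact door_erase y hyσ himy
    · have hσ' : σ.image c = (insert (c x) C).erase i₀ := by
        rw [hσ, Finset.erase_insert_of_ne hne]
      refine ⟨1, Finset.card_eq_two.2 ⟨(σ.erase x, C), (σ, insert (c x) C), ?_, ?_⟩⟩
      · intro h
        exact Finset.notMem_erase x σ (by rw [(Prod.mk.inj h).1]; exact hx)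
      · ext ⟨τ, D⟩
        simp only [Finset.mem_filter, Finset.mem_insert, Finset.mem_singleton]
        constructor
        · rintro ⟨hd, hτσ, hCD⟩
          obtain ⟨-, hdc, hiD, hdim⟩ := mem_doors.1 hd
          rcases incident_cases hdc hcard hτσ hCD with ⟨rfl, j, hj, rfl⟩ | ⟨rfl, z, hz, rfl⟩
          · right
            have hxD : c x ∈ D := by
              have := Finset.mem_image_of_mem c hx
              rw [hdim] at this
              exact Finset.mem_of_mem_erase this
            have hxj : c x = j := by
              by_contra h
              exact hcx (Finset.mem_erase.2 ⟨h, hxD⟩)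
            rw [hxj, Finset.insert_erase hj]
          · left
            have hzx : z = x := by
              by_contra h
              have hxτ : x ∈ τ := (Finset.mem_insert.1 hx).resolve_left (Ne.symm h)
              have := Finset.mem_image_of_mem c hxτ
              rw [hdim] at this
              exact hcx (Finset.mem_of_mem_erase this)
            subst hzx
            rw [Finset.erase_insert hz]
        · rintro (h | h)
          · obtain ⟨rfl, rfl⟩ := Prod.mk.inj h
            exact door_erase x hx him
          · obtain ⟨rfl, rfl⟩ := Prod.mk.inj h
            exact ⟨mem_doors.2 ⟨hdom.mono (Finset.Subset.refl _) (Finset.subset_insert _ _),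
              by rw [Finset.card_insert_of_notMem hcx, hcard],
              Finset.mem_insert_of_mem hi, hσ'⟩, Finset.Subset.refl _, Finset.subset_insert _ _⟩
  · refine ⟨0, Finset.card_eq_zero.2 (Finset.filter_eq_empty_iff.2 ?_)⟩
    rintro ⟨τ, D⟩ hd ⟨hτσ, hCD⟩
    obtain ⟨-, hdc, hiD, hdim⟩ := mem_doors.1 hd
    refine hdoor ?_
    rcases incident_cases hdc hcard hτσ hCD with ⟨rfl, j, hj, rfl⟩ | ⟨rfl, z, hz, rfl⟩
    -- A door that adds a criterion `j` comes with a removal door: remove the point of colour `j`.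
    · have hji : j ≠ i₀ := by
        rintro rfl
        exact hcol hdim
      have hj' : j ∈ σ.image c := by rw [hdim]; exact Finset.mem_erase.2 ⟨hji, hj⟩
      obtain ⟨x, hx, rfl⟩ := Finset.mem_image.1 hj'
      refine ⟨x, hx, Finset.mem_erase.2 ⟨hji.symm, hiD⟩, ?_⟩
      have hinj : Set.InjOn c σ := by
        refine Finset.card_image_iff.1 ?_
        rw [hdim, Finset.card_erase_of_mem hiD]; omega
      rw [Finset.erase_right_comm, ← hdim]
      ext t
      simp only [Finset.mem_image, Finset.mem_erase]
      constructor
      · rintro ⟨z, ⟨hzx, hz⟩, rfl⟩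
        exact ⟨fun h => hzx (hinj hz hx h), z, hz, rfl⟩
      · rintro ⟨h, z, hz, rfl⟩
        exact ⟨z, ⟨fun e => h (e ▸ rfl), hz⟩, rfl⟩
    · exact ⟨z, Finset.mem_insert_self _ _, hiD, by rw [Finset.erase_insert hz, hdim]⟩

/-- **Scarf's lemma** for finitely many linear orders: every colouring has a colourful dominant
cell. -/
theorem exists_dominant_image_eq [Nonempty I] [Nonempty T] (hk : ∀ i, Function.Injective (k i))
    (c : T → I) : ∃ σ C, Dominant k σ C ∧ σ.image c = C := by
  classical
  obtain ⟨i₀⟩ := ‹Nonempty I›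
  by_contra hno
  push Not at hno
  have hdc := Finset.sum_card_bipartiteAbove_eq_sum_card_bipartiteBelow
    (s := doors k c i₀) (t := cells k) Incident
  have hright : Even (∑ r ∈ cells k, ((doors k c i₀).bipartiteBelow Incident r).card) := by
    refine Finset.even_sum _ ?_
    rintro ⟨σ, C⟩ hr
    exact even_card_doors_of_cell hr (hno σ C (mem_cells.1 hr).1)
  have houter : ((∅ : Finset T), ({i₀} : Finset I)) ∈ doors k c i₀ :=
    mem_doors.2 ⟨fun y => ⟨i₀, by simp, by simp⟩, by simp, by simp, by simp⟩
  rw [← hdc, ← Finset.add_sum_erase _ _ houter] at hright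
  have hrest : Even (∑ d ∈ (doors k c i₀).erase (∅, {i₀}),
      ((cells k).bipartiteAbove Incident d).card) := by
    refine Finset.even_sum _ ?_
    rintro ⟨τ, D⟩ hd
    obtain ⟨hne, hd⟩ := Finset.mem_erase.1 hd
    obtain ⟨hdom, hcard, hi, -⟩ := mem_doors.1 hd
    -- The outer door is the only one without points, since `D` is then a singleton containing `i₀`.
    have hτ : τ.Nonempty := by
      rw [Finset.nonempty_iff_ne_empty]
      rintro rfl
      refine hne ?_
      obtain ⟨j, rfl⟩ := Finset.card_eq_one.1 hcard.symm
      rw [Finset.mem_singleton.1 hi]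
    exact ⟨1, card_cells_of_door hk hdom hcard hτ⟩
  have h1 : ((cells k).bipartiteAbove Incident ((∅ : Finset T), ({i₀} : Finset I))).card = 1 :=
    card_cells_of_outer_door hk i₀
  rw [h1] at hright
  exact absurd ((Nat.even_add.1 hright).2 hrest) (by decide)

end Scarf

/-! ### Scarf's lemma on the lattice points of a simplex. -/

/-- Every colouring of the lattice points of the simplex of size `n` admits lattice points, close
to each other, such that the `i`-th one has colour `i` or a small `i`-th coordinate. -/
theorem exists_close_lattice_points {I : Type*} [Fintype I] [DecidableEq I] [Nonempty I] (n : ℕ)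
    (c : (I → ℕ) → I) :
    ∃ w : I → I → ℕ, (∀ i, ∑ t, w i t = n) ∧ (∀ i j t, w i t ≤ w j t + Fintype.card I) ∧
      ∀ i, c (w i) = i ∨ w i i ≤ Fintype.card I := by
  classical
  let T := {y : I → ℕ // y ∈ Finset.piAntidiag Finset.univ n}
  let : Fintype T := inferInstanceAs (Fintype {y // y ∈ Finset.piAntidiag Finset.univ n})
  have hT : ∀ y : I → ℕ, ∑ t, y t = n → y ∈ Finset.piAntidiag Finset.univ n := fun y hy => by
    simp [Finset.mem_piAntidiag, hy]
  have hsum : ∀ y : T, ∑ t, y.1 t = n := fun y => (Finset.mem_piAntidiag.1 y.2).1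
  -- The coordinate orders, with ties broken by an enumeration of `T` to make them injective.
  let k : I → T → ℕ ×ₗ Fin (Fintype.card T) := fun i y => toLex (y.1 i, Fintype.equivFin T y)
  have hk : ∀ i, Function.Injective (k i) := fun i y z h =>
    (Fintype.equivFin T).injective (Prod.mk.inj (toLex.injective h)).2
  have hle : ∀ i y z, k i y ≤ k i z → y.1 i ≤ z.1 i := by
    intro i y z h
    rcases Prod.Lex.le_iff.1 h with h | h
    · exact h.le
    · exact h.1.le
  obtain ⟨i₁⟩ := ‹Nonempty I›
  have : Nonempty T := ⟨⟨Pi.single i₁ n, hT _ (by simp)⟩⟩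
  have : Nonempty I := ⟨i₁⟩
  obtain ⟨σ, C, hdom, hcol⟩ := exists_dominant_image_eq hk (fun y : T => c y.1)
  obtain ⟨i₀, hi₀, -⟩ := hdom (Classical.arbitrary T)
  have hmem : ∀ i ∈ C, ∃ x ∈ σ, c x.1 = i := fun i hi => by
    rw [← hcol] at hi
    exact Finset.mem_image.1 hi
  obtain ⟨x₀, hx₀, -⟩ := hmem i₀ hi₀
  choose m hmσ hmin using fun i => σ.exists_min_image (fun x => x.1 i) ⟨x₀, hx₀⟩
  -- Otherwise the lattice point `y`, one above the minimum of `σ` in each coordinate of `C` and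
  -- with the surplus placed at `i₀`, beats `σ` in all of `C`.
  have hlt : n < ∑ t ∈ C, ((m t).1 t + 1) := by
    by_contra! hn
    let y : I → ℕ := fun t => (if t ∈ C then (m t).1 t + 1 else 0) +
      if t = i₀ then n - ∑ t ∈ C, ((m t).1 t + 1) else 0
    have hy : ∑ t, y t = n := by
      simp only [y, Finset.sum_add_distrib, Finset.sum_ite_mem, Finset.univ_inter,
        Finset.sum_ite_eq', Finset.mem_univ, if_true]
      simp only [Finset.sum_add_distrib] at hn ⊢
      omega
    obtain ⟨i, hi, h⟩ := hdom ⟨y, hT y hy⟩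
    have h1 : y i ≤ (m i).1 i := hle i _ _ (h _ (hmσ i))
    simp only [y, if_pos hi] at h1
    omega
  -- A lower corner for `σ`. By `hlt` its sum falls short of `n` by at most `Fintype.card I`, which
  -- confines `σ` to a box of that side; outside `C` the corner is `0`, so coordinates there are
  -- small.
  let b : I → ℕ := fun t => if t ∈ C then (m t).1 t else 0
  have hb : n ≤ ∑ t, b t + Fintype.card I := by
    have h1 : ∑ t, b t = ∑ t ∈ C, (m t).1 t := by
      simp only [b, Finset.sum_ite_mem, Finset.univ_inter]
    have h2 := Finset.card_le_univ C
    rw [Finset.sum_add_distrib, Finset.sum_const, smul_eq_mul, mul_one] at hlt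
    omega
  have hbx : ∀ x ∈ σ, ∀ t, b t ≤ x.1 t := by
    intro x hx t
    by_cases ht : t ∈ C
    · simpa only [b, if_pos ht] using hmin t x hx
    · simp [b, if_neg ht]
  have hxb : ∀ x ∈ σ, ∀ t, x.1 t ≤ b t + Fintype.card I := by
    intro x hx t
    have h1 := hsum x
    rw [← Finset.add_sum_erase _ _ (Finset.mem_univ t)] at h1 hb
    have h2 : ∑ s ∈ Finset.univ.erase t, b s ≤ ∑ s ∈ Finset.univ.erase t, x.1 s :=
      Finset.sum_le_sum fun s _ => hbx x hx s
    omega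
  have hw : ∀ i, ∃ x ∈ σ, i ∈ C → c x.1 = i := fun i => by
    by_cases hi : i ∈ C
    · obtain ⟨x, hx, h⟩ := hmem i hi
      exact ⟨x, hx, fun _ => h⟩
    · exact ⟨x₀, hx₀, fun h => absurd h hi⟩
  choose w hwσ hwc using hw
  refine ⟨fun i => (w i).1, fun i => hsum _, fun i j t => ?_, fun i => ?_⟩
  · exact (hxb _ (hwσ i) t).trans (Nat.add_le_add_right (hbx _ (hwσ j) t) _)
  · by_cases hi : i ∈ C
    · exact Or.inl (hwc i hi)
    · right
      simpa [b, if_neg hi] using hxb _ (hwσ i) i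

/-! ### A covering theorem for the simplex. -/

/-- If closed sets `A i` cover the standard simplex, then some point of the simplex lies in `A i`
for every `i` in its support. -/
theorem exists_mem_of_stdSimplex_subset_iUnion {I : Type*} [Fintype I] [Nonempty I]
    {A : I → Set (I → ℝ)} (hA : ∀ i, IsClosed (A i)) (hcov : stdSimplex ℝ I ⊆ ⋃ i, A i) :
    ∃ x ∈ stdSimplex ℝ I, ∀ i, x ∈ A i ∨ x i = 0 := by
  classical
  -- Lattice size `n + 1` rather than `n` avoids division by zero.
  let s : ℕ → (I → ℕ) → I → ℝ := fun n y t => (y t : ℝ) / (n + 1)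
  have hs : ∀ n y, ∑ t, y t = n + 1 → s n y ∈ stdSimplex ℝ I := by
    intro n y hy
    refine ⟨fun t => by positivity, ?_⟩
    simp only [s, ← Finset.sum_div]
    rw [← Nat.cast_sum, hy]
    push_cast
    exact div_self (by positivity)
  have hc : ∀ n y, ∃ i, ∑ t, y t = n + 1 → s n y ∈ A i := fun n y => by
    by_cases hy : ∑ t, y t = n + 1
    · obtain ⟨i, hi⟩ := mem_iUnion.1 (hcov (hs n y hy))
      exact ⟨i, fun _ => hi⟩
    · exact ⟨Classical.arbitrary I, fun h => absurd h hy⟩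
  choose c hc using hc
  choose w hwsum hwclose hwc using fun n => exists_close_lattice_points (n + 1) (c n)
  obtain ⟨i₀⟩ := ‹Nonempty I›
  obtain ⟨x, hx, φ, hφ, hlim⟩ := (isCompact_stdSimplex ℝ I).tendsto_subseq
    (fun n => hs n (w n i₀) (hwsum n i₀))
  have hzero : Filter.Tendsto (fun n => (Fintype.card I : ℝ) / ((φ n : ℝ) + 1)) Filter.atTop
      (nhds 0) := by
    have h1 : Filter.Tendsto (fun n : ℕ => (Fintype.card I : ℝ) / ((n : ℝ) + 1)) Filter.atTop
        (nhds 0) :=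
      tendsto_const_nhds.div_atTop
        (Filter.tendsto_atTop_add_const_right _ _ tendsto_natCast_atTop_atTop)
    exact h1.comp hφ.tendsto_atTop
  have hlim' : ∀ i, Filter.Tendsto (fun n => s (φ n) (w (φ n) i)) Filter.atTop (nhds x) := by
    intro i
    rw [tendsto_pi_nhds] at hlim ⊢
    intro t
    refine tendsto_of_tendsto_of_dist (hlim t) (squeeze_zero (fun _ => dist_nonneg) ?_ hzero)
    intro n
    have hpos : (0 : ℝ) < (φ n : ℝ) + 1 := by positivity
    have h1 : (w (φ n) i t : ℝ) ≤ w (φ n) i₀ t + Fintype.card I := by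
      exact_mod_cast hwclose (φ n) i i₀ t
    have h2 : (w (φ n) i₀ t : ℝ) ≤ w (φ n) i t + Fintype.card I := by
      exact_mod_cast hwclose (φ n) i₀ i t
    rw [Real.dist_eq]
    simp only [s, Function.comp]
    rw [← sub_div, abs_div, abs_of_pos hpos]
    gcongr
    rw [abs_le]
    constructor <;> linarith
  refine ⟨x, hx, fun i => ?_⟩
  -- If colour `i` recurs, closedness puts the limit in `A i`; if not, the `i`-th coordinate is
  -- eventually at most `Fintype.card I / (φ n + 1)`, which tends to `0`.
  by_cases hfreq : ∃ᶠ n in Filter.atTop, c (φ n) (w (φ n) i) = i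
  · left
    refine (hA i).mem_of_frequently_of_tendsto (hfreq.mono fun n hn => ?_) (hlim' i)
    have := hc (φ n) (w (φ n) i) (hwsum _ i)
    rwa [hn] at this
  · right
    rw [Filter.not_frequently] at hfreq
    refine le_antisymm ?_ (hx.1 i)
    refine le_of_tendsto_of_tendsto (tendsto_pi_nhds.1 (hlim' i) i) hzero ?_
    filter_upwards [hfreq] with n hn
    have h1 : (w (φ n) i i : ℝ) ≤ Fintype.card I := by
      exact_mod_cast (hwc (φ n) i).resolve_left hn
    simp only [s]
    gcongr

/-! ### Existence of a Wardrop equilibrium. -/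

theorem mainTheorem7 (N : ℕ)
    (p : Fin N → ℝ) (hp : ∀ i, 0 < p i)
    (u : ℝ → ℝ)
    (hu_cont : ContinuousOn u (Ici 0))
    (hu_bdd : Bornology.IsBounded (u '' Ici 0))
    (hu_nonneg : ∀ t ∈ Ici (0 : ℝ), 0 ≤ u t)
    (hu_anti : AntitoneOn u (Ici 0))
    (l : Fin N → (Fin N → ℝ) → ℝ)
    (hl_cont : ∀ i, ContinuousOn (l i) (flowOrthant N))
    (hl_ge : ∀ i, ∀ x ∈ flowOrthant N, x i ≤ l i x) :
    ∃ x : Fin N → ℝ, IsWardropEquilibrium p l u x := by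
  classical
  obtain ⟨M, hM⟩ := hu_bdd.bddAbove
  have huM : ∀ t ∈ Ici (0 : ℝ), u t ≤ M := fun t ht => hM (mem_image_of_mem u ht)
  have hM0 : 0 ≤ M := (hu_nonneg 0 self_mem_Ici).trans (huM 0 self_mem_Ici)
  -- Strictly more than `N` flows bounded by `M` can total, so the slack cannot vanish.
  let R : ℝ := N * M + 1
  have hR : 0 < R := by positivity
  let Δ := stdSimplex ℝ (Option (Fin N))
  have hΔ : IsClosed Δ := isClosed_stdSimplex ℝ (Option (Fin N))
  let f : (Option (Fin N) → ℝ) → Fin N → ℝ := fun x i => R * x (some i)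
  have hf : Continuous f := by fun_prop
  have hfO : MapsTo f Δ (flowOrthant N) := fun x hx i => mul_nonneg hR.le (hx.1 _)
  have hfS : MapsTo (fun x => ∑ j, f x j) Δ (Ici 0) := fun x hx =>
    Finset.sum_nonneg fun i _ => hfO hx i
  have hd : ∀ i, ContinuousOn (fun x => disutility p l (f x) i) Δ := fun i =>
    continuousOn_const.add ((hl_cont i).comp hf.continuousOn hfO)
  have hu : ContinuousOn (fun x => u (∑ j, f x j)) Δ :=
    hu_cont.comp (Continuous.continuousOn (by fun_prop)) hfS
  let A : Option (Fin N) → Set (Option (Fin N) → ℝ) := fun o => o.elim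
    (⋂ i, {x ∈ Δ | u (∑ j, f x j) ≤ disutility p l (f x) i})
    (fun i => {x ∈ Δ | disutility p l (f x) i ≤ u (∑ j, f x j)})
  have hA : ∀ o, IsClosed (A o) := by
    rintro (_ | i)
    · exact isClosed_iInter fun i => hΔ.isClosed_le hu (hd i)
    · exact hΔ.isClosed_le (hd i) hu
  have hcov : Δ ⊆ ⋃ o, A o := by
    intro x hx
    by_cases h : ∃ i, disutility p l (f x) i ≤ u (∑ j, f x j)
    · obtain ⟨i, hi⟩ := h
      exact mem_iUnion.2 ⟨some i, hx, hi⟩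
    · push Not at h
      exact mem_iUnion.2 ⟨none, mem_iInter.2 fun i => ⟨hx, (h i).le⟩⟩
  obtain ⟨x, hx, hxA⟩ := exists_mem_of_stdSimplex_subset_iUnion hA hcov
  have hused : ∀ i, 0 < f x i → disutility p l (f x) i ≤ u (∑ j, f x j) := by
    intro i hi
    rcases hxA (some i) with h | h
    · exact h.2
    · simp [f, h] at hi
  -- For a used access point, `x i ≤ l i x ≤ p i + l i x ≤ u ≤ M` at the flow `f x`.
  have hfM : ∀ i, f x i ≤ M := by
    intro i
    rcases (hfO hx i).eq_or_lt with h | h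
    · rw [← h]; exact hM0
    · have h1 := hused i h
      have h2 := hl_ge i _ (hfO hx)
      have h3 := huM _ (hfS hx)
      have h4 := hp i
      unfold disutility at h1
      linarith
  have hnone : x none ≠ 0 := by
    intro h
    have h1 : ∑ j, f x j = R := by
      have := hx.2
      rw [Fintype.sum_option, h, zero_add] at this
      simp only [f, ← Finset.mul_sum, this, mul_one]
    have h2 : ∑ j, f x j ≤ N * M := by
      simpa using Finset.sum_le_sum fun i (_ : i ∈ Finset.univ) => hfM i
    simp only [R] at h1
    linarith
  have hge : ∀ i, u (∑ j, f x j) ≤ disutility p l (f x) i := fun i =>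
    (mem_iInter.1 ((hxA none).resolve_right hnone) i).2
  exact ⟨f x, hfO hx, fun i hi => le_antisymm (hused i hi) (hge i), fun i _ => hge i⟩
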